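/- Theorem 3.8. Let $\Omega = I_1 \cup \dots \cup I_n \subset \mathbb{R}$ be a finite union of pairwise disjoint bounded intervals, where $I_i$ (open, closed or half-open) has endpoints $a_i < b_i$, the intervals are listed from left to right ($a_1 < a_2 < \dots < a_n$), and every length $b_i - a_i$ is an integer. Call a positive, locally finite Borel measure $\nu$ on $\mathbb{R}$ a weak tiling measure for $\Omega$ if $\mathbf{1}_{\Omega} * \nu = \mathbf{1}_{\mathbb{R}\setminus\Omega}$ Lebesgue-a.e., where $(\mathbf{1}_\Omega * \nu)(x) = \int \mathbf{1}_\Omega(x-t)\, d\nu(t)$; and say that $\Omega$ weakly tiles its complement if it admits a weak tiling measure. If $\Omega$ weakly tiles its complement, then (i) all the gaps between consecutive intervals have integer lengths, i.e. $a_{k+1} - b_k \in \mathbb{Z}$ for all $1 \le k < n$; (ii) every weak tiling measure $\nu$ for $\Omega$ satisfies $\operatorname{supp}(\nu) \subset \mathbb{Z} \setminus \{0\}$, where $\operatorname{supp}(\nu)$ is the closed support of $\nu$. -/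

import Mathlib

open MeasureTheory
open scoped ENNReal

/-- The convolution `1_A ∗ ν` of the indicator function of `A ⊆ ℝ` with a (positive) measure `ν`
on `ℝ`, that is, `x ↦ ∫ 1_A(x - t) dν(t)`, with values in `[0, ∞]`. -/
noncomputable def indicatorConv (A : Set ℝ) (ν : Measure ℝ) (x : ℝ) : ℝ≥0∞ :=
  ∫⁻ t, A.indicator (fun _ => (1 : ℝ≥0∞)) (x - t) ∂ν

/-- `ν` is a weak tiling measure for the (bounded, measurable) set `A ⊆ ℝ`: a positive, locally
finite (Borel) measure on `ℝ` such that `1_A ∗ ν = 1_{Aᶜ}` Lebesgue-almost everywhere. -/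
def IsWeakTilingMeasure (ν : Measure ℝ) (A : Set ℝ) : Prop :=
  IsLocallyFiniteMeasure ν ∧
    ∀ᵐ x ∂(volume : Measure ℝ), indicatorConv A ν x = Aᶜ.indicator (fun _ => (1 : ℝ≥0∞)) x

/-- `A` weakly tiles its complement: it admits a weak tiling measure. -/
def WeaklyTilesComplement (A : Set ℝ) : Prop :=
  ∃ ν : Measure ℝ, IsWeakTilingMeasure ν A

/-- `I` is a nondegenerate bounded interval with left endpoint `a` and right endpoint `b`; each
endpoint may or may not belong to `I`, so that `I` is open, closed or half-open. -/
def IsIntervalWithEndpoints (I : Set ℝ) (a b : ℝ) : Prop :=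
  a < b ∧ Set.Ioo a b ⊆ I ∧ I ⊆ Set.Icc a b

/-! The measure `μ = δ₀ + ν` satisfies `1_Ω ∗ μ = 1` almost everywhere. Since the intervals have
integer lengths, cutting them into unit intervals writes `1_Ω` as `1_{[0,1)} ∗ P`, up to finitely
many points, where `P` is the finite sum of the unit masses at the points `p = a i + l` with
`0 ≤ l < b i - a i`. So `ρ = P ∗ μ` is a positive measure giving mass one to almost every half-open
window of length one. But `ρ ≥ P ∗ δ₀ = P` has an atom of mass at least one at each such `p`.
An atom of that size exhausts every window containing it, so there is nothing else at distance
less than one from it, and sliding the window past it forces an atom of mass one at `p ± 1`.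
Hence `ρ` is carried by `p + ℤ` (`measure_compl_range_add_int_eq_zero`).
All the `a i` are therefore congruent modulo one, and `ν` is carried by `ℤ`, because the translate
of `ν` by `p` is at most `ρ`. Finally `ρ {p} ≤ 1` leaves no room for an atom of `ν` at `0`. -/

/-! ### Measures giving mass one to unit windows -/

section UnitWindows

variable {ρ : Measure ℝ}

/-- A point `x` whose window `(x - 1, x]` has mass one exists in each nonempty open interval. -/
lemma exists_mem_Ioo_measure_Ioc_eq_one (h : ∀ᵐ x ∂(volume : Measure ℝ), ρ (Set.Ioc (x - 1) x) = 1)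
    {u v : ℝ} (huv : u < v) : ∃ x ∈ Set.Ioo u v, ρ (Set.Ioc (x - 1) x) = 1 := by
  obtain ⟨x, hx, hx'⟩ := (Measure.dense_of_ae h).exists_between huv
  exact ⟨x, hx', hx⟩

lemma measure_singleton_le_one (h : ∀ᵐ x ∂(volume : Measure ℝ), ρ (Set.Ioc (x - 1) x) = 1)
    (p : ℝ) : ρ {p} ≤ 1 := by
  obtain ⟨x, hx, hx1⟩ := exists_mem_Ioo_measure_Ioc_eq_one h (lt_add_one p)
  rw [← hx1]
  refine measure_mono ?_
  rintro y rfl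
  exact ⟨by linarith [hx.2], hx.1.le⟩

/-- An atom of full mass exhausts every window that contains it. -/
lemma measure_Ioo_diff_singleton_eq_zero
    (h : ∀ᵐ x ∂(volume : Measure ℝ), ρ (Set.Ioc (x - 1) x) = 1) {p : ℝ} (hp : 1 ≤ ρ {p}) :
    ρ (Set.Ioo (p - 1) (p + 1) \ {p}) = 0 := by
  refine measure_null_of_locally_null _ fun y hy => ?_
  have hlt : max y p < min y p + 1 := by
    obtain ⟨⟨h1, h2⟩, -⟩ := hy
    rcases le_total y p with hyp | hyp
    · rw [max_eq_right hyp, min_eq_left hyp]; linarith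
    · rw [max_eq_left hyp, min_eq_right hyp]; linarith
  obtain ⟨x, ⟨hx1, hx2⟩, hx⟩ := exists_mem_Ioo_measure_Ioc_eq_one h hlt
  rw [max_lt_iff] at hx1
  rw [← sub_lt_iff_lt_add, lt_min_iff] at hx2
  refine ⟨Set.Ioc (x - 1) x \ {p}, ?_, ?_⟩
  · rw [Set.sdiff_eq, Set.sdiff_eq]
    refine Filter.inter_mem (mem_nhdsWithin_of_mem_nhds (Ioc_mem_nhds hx2.1 hx1.1)) ?_
    exact Filter.mem_of_superset self_mem_nhdsWithin Set.inter_subset_right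
  · have hsub : ({p} : Set ℝ) ⊆ Set.Ioc (x - 1) x := by
      rintro z rfl
      exact ⟨hx2.2, hx1.2.le⟩
    have hle : ρ {p} ≤ 1 := measure_singleton_le_one h p
    rw [measure_sdiff hsub (measurableSet_singleton p).nullMeasurableSet
      (hle.trans_lt ENNReal.one_lt_top).ne, hx]
    exact tsub_eq_zero_of_le hp

lemma one_le_measure_singleton_of_closedBall
    (h : ∀ᵐ x ∂(volume : Measure ℝ), ρ (Set.Ioc (x - 1) x) = 1) {q : ℝ}
    (hq : ∀ ε : ℝ, 0 < ε → ε < 1 → 1 ≤ ρ (Metric.closedBall q ε)) : 1 ≤ ρ {q} := by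
  have hlim : Filter.Tendsto (fun r => ρ (Metric.cthickening r {q})) (nhds 0) (nhds (ρ {q})) := by
    refine tendsto_measure_cthickening_of_isClosed ⟨1 / 4, by norm_num, ?_⟩ isClosed_singleton
    obtain ⟨x, hx, hx1⟩ := exists_mem_Ioo_measure_Ioc_eq_one h
      (show q + 1 / 4 < q + 3 / 4 by linarith)
    refine ((measure_mono ?_).trans_lt (hx1.trans_lt ENNReal.one_lt_top)).ne
    rw [Metric.cthickening_singleton _ (by norm_num), Real.closedBall_eq_Icc]
    intro y hy
    exact ⟨by linarith [hy.1, hx.2], by linarith [hy.2, hx.1]⟩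
  refine ge_of_tendsto (hlim.mono_left (nhdsWithin_le_nhds (s := Set.Ioi 0))) ?_
  filter_upwards [Ioo_mem_nhdsGT (zero_lt_one (α := ℝ))] with ε hε
  rw [Metric.cthickening_singleton _ hε.1.le]
  exact hq ε hε.1 hε.2

/-- A window that has just moved past the atom `p` has its whole mass close to `p + 1`. -/
lemma one_le_measure_singleton_add_one
    (h : ∀ᵐ x ∂(volume : Measure ℝ), ρ (Set.Ioc (x - 1) x) = 1) {p : ℝ} (hp : 1 ≤ ρ {p}) :
    1 ≤ ρ {p + 1} := by
  refine one_le_measure_singleton_of_closedBall h fun ε hε _ => ?_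
  obtain ⟨x, hx, hx1⟩ := exists_mem_Ioo_measure_Ioc_eq_one h
    (show p + 1 < p + 1 + ε by linarith)
  have hsub : Set.Ioc (x - 1) x ⊆
      (Set.Ioo (p - 1) (p + 1) \ {p}) ∪ Metric.closedBall (p + 1) ε := by
    intro y hy
    rw [Real.closedBall_eq_Icc]
    rcases lt_or_ge y (p + 1) with hy' | hy'
    · exact Or.inl ⟨⟨by linarith [hy.1, hx.1], hy'⟩, by
        rintro rfl; linarith [hy.1, hx.1]⟩
    · exact Or.inr ⟨by linarith, by linarith [hy.2, hx.2]⟩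
  calc (1 : ℝ≥0∞) = ρ (Set.Ioc (x - 1) x) := hx1.symm
    _ ≤ _ := measure_mono hsub
    _ ≤ _ := measure_union_le _ _
    _ = _ := by rw [measure_Ioo_diff_singleton_eq_zero h hp, zero_add]

/-- A window that has not yet reached the atom `p` has its whole mass close to `p - 1`. -/
lemma one_le_measure_singleton_sub_one
    (h : ∀ᵐ x ∂(volume : Measure ℝ), ρ (Set.Ioc (x - 1) x) = 1) {p : ℝ} (hp : 1 ≤ ρ {p}) :
    1 ≤ ρ {p - 1} := by
  refine one_le_measure_singleton_of_closedBall h fun ε hε _ => ?_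
  obtain ⟨x, hx, hx1⟩ := exists_mem_Ioo_measure_Ioc_eq_one h (show p - ε < p by linarith)
  have hsub : Set.Ioc (x - 1) x ⊆
      (Set.Ioo (p - 1) (p + 1) \ {p}) ∪ Metric.closedBall (p - 1) ε := by
    intro y hy
    rw [Real.closedBall_eq_Icc]
    rcases lt_or_ge (p - 1) y with hy' | hy'
    · exact Or.inl ⟨⟨hy', by linarith [hy.2, hx.2]⟩, by
        rintro rfl; linarith [hy.2, hx.2]⟩
    · exact Or.inr ⟨by linarith [hy.1, hx.1], by linarith⟩
  calc (1 : ℝ≥0∞) = ρ (Set.Ioc (x - 1) x) := hx1.symm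
    _ ≤ _ := measure_mono hsub
    _ ≤ _ := measure_union_le _ _
    _ = _ := by rw [measure_Ioo_diff_singleton_eq_zero h hp, zero_add]

lemma one_le_measure_singleton_add_int
    (h : ∀ᵐ x ∂(volume : Measure ℝ), ρ (Set.Ioc (x - 1) x) = 1) {p : ℝ} (hp : 1 ≤ ρ {p})
    (k : ℤ) : 1 ≤ ρ {p + k} := by
  induction k with
  | zero => simpa using hp
  | succ k ih =>
    have := one_le_measure_singleton_add_one h ih
    push_cast at this ⊢
    rwa [← add_assoc]
  | pred k ih =>
    have := one_le_measure_singleton_sub_one h ih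
    push_cast at this ⊢
    rwa [← add_sub_assoc]

/-- A measure giving mass one to almost every unit window and mass at least one to `{p}` is carried
by `p + ℤ`. -/
lemma measure_compl_range_add_int_eq_zero
    (h : ∀ᵐ x ∂(volume : Measure ℝ), ρ (Set.Ioc (x - 1) x) = 1) {p : ℝ} (hp : 1 ≤ ρ {p}) :
    ρ (Set.range fun k : ℤ => p + k)ᶜ = 0 := by
  refine measure_mono_null (t := ⋃ k : ℤ, Set.Ioo (p + k - 1) (p + k + 1) \ {p + (k : ℝ)}) ?_
    (measure_iUnion_null fun k => measure_Ioo_diff_singleton_eq_zero h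
      (one_le_measure_singleton_add_int h hp k))
  intro y hy
  refine Set.mem_iUnion.2 ⟨⌊y - p⌋, ⟨?_, ?_⟩, fun hy' => hy ⟨_, (Set.mem_singleton_iff.1 hy').symm⟩⟩
  · linarith [Int.floor_le (y - p)]
  · linarith [Int.lt_floor_add_one (y - p)]

end UnitWindows

/-! ### Cutting the intervals into unit intervals -/

lemma IsIntervalWithEndpoints.measurableSet {I : Set ℝ} {a b : ℝ}
    (h : IsIntervalWithEndpoints I a b) : MeasurableSet I := by
  have hI : I = Set.Ioo a b ∪ (I ∩ {a, b}) := by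
    ext y
    constructor
    · intro hy
      obtain ⟨h1, h2⟩ := h.2.2 hy
      rcases h1.eq_or_lt with rfl | h1
      · exact Or.inr ⟨hy, by simp⟩
      rcases h2.eq_or_lt with rfl | h2
      · exact Or.inr ⟨hy, by simp⟩
      exact Or.inl ⟨h1, h2⟩
    · rintro (hy | hy)
      · exact h.2.1 hy
      · exact hy.1
  rw [hI]
  exact measurableSet_Ioo.union ((Set.toFinite _).inter_of_right I).measurableSet

lemma indicatorConv_eq_measure_preimage {A : Set ℝ} (hA : MeasurableSet A) (μ : Measure ℝ)
    (x : ℝ) : indicatorConv A μ x = μ ((fun t => x - t) ⁻¹' A) := by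
  have hm : MeasurableSet ((fun t => x - t) ⁻¹' A) := (measurable_const.sub measurable_id) hA
  rw [← lintegral_indicator_one hm]
  rfl

/-- Adding to a weak tiling measure the unit mass at `0`, which accounts for the set itself, gives a
weighted tiling of the line. -/
lemma IsWeakTilingMeasure.indicatorConv_dirac_add {ν : Measure ℝ} {A : Set ℝ}
    (h : IsWeakTilingMeasure ν A) :
    ∀ᵐ x ∂(volume : Measure ℝ), indicatorConv A (Measure.dirac 0 + ν) x = 1 := by
  filter_upwards [h.2] with x hx
  unfold indicatorConv at hx ⊢
  rw [lintegral_add_measure, hx, lintegral_dirac, sub_zero]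
  by_cases hxA : x ∈ A <;> simp [hxA]

/-- A σ-finite measure has countably many atoms, so almost every translate of a point avoids
them. -/
lemma ae_measure_singleton_sub_eq_zero (μ : Measure ℝ) [SigmaFinite μ] (c : ℝ) :
    ∀ᵐ x ∂(volume : Measure ℝ), μ {x - c} = 0 := by
  have hc : {y : ℝ | 0 < μ {y}}.Countable :=
    Measure.countable_meas_pos_of_disjoint_iUnion (fun y => measurableSet_singleton y)
      (fun y z hyz => Set.disjoint_singleton.2 hyz)
  have hc' : ((fun x : ℝ => x - c) ⁻¹' {y : ℝ | 0 < μ {y}}).Countable :=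
    hc.preimage sub_left_injective
  filter_upwards [hc'.ae_notMem volume] with x hx
  simpa using hx

lemma IsIntervalWithEndpoints.measure_preimage_sub {I : Set ℝ} {a b x : ℝ}
    (h : IsIntervalWithEndpoints I a b) {μ : Measure ℝ} (ha : μ {x - a} = 0)
    (hb : μ {x - b} = 0) :
    μ ((fun t => x - t) ⁻¹' I) = μ (Set.Ioc (x - b) (x - a)) := by
  refine le_antisymm ?_ ?_
  · have hsub : (fun t => x - t) ⁻¹' I ⊆ {x - b} ∪ Set.Ioc (x - b) (x - a) := by
      intro t ht
      obtain ⟨h1, h2⟩ := h.2.2 ht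
      have h2' : x - b ≤ t := by linarith
      rcases h2'.eq_or_lt with rfl | h2'
      · exact Or.inl rfl
      · exact Or.inr ⟨h2', by linarith⟩
    calc _ ≤ _ := measure_mono hsub
      _ ≤ _ := measure_union_le _ _
      _ = _ := by rw [hb, zero_add]
  · have hsub : Set.Ioc (x - b) (x - a) ⊆ {x - a} ∪ (fun t => x - t) ⁻¹' I := by
      intro t ht
      rcases ht.2.eq_or_lt with rfl | h2
      · exact Or.inl rfl
      · exact Or.inr (h.2.1 ⟨by linarith, by linarith [ht.1]⟩)
    calc _ ≤ _ := measure_mono hsub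
      _ ≤ _ := measure_union_le _ _
      _ = _ := by rw [ha, zero_add]

/-- The window `(x - (a + m), x - a]` splits into `m` unit windows, each of them the preimage of
`(x - 1, x]` under one of the translations. -/
lemma sum_map_add_apply_Ioc (μ : Measure ℝ) (a x : ℝ) (m : ℕ) :
    ∑ l ∈ Finset.range m, μ.map (· + (a + l)) (Set.Ioc (x - 1) x) =
      μ (Set.Ioc (x - (a + m)) (x - a)) := by
  induction m with
  | zero => simp
  | succ m ih =>
    rw [Finset.sum_range_succ, ih, Measure.map_apply (measurable_add_const _) measurableSet_Ioc,
      Set.preimage_add_const_Ioc, add_comm, ← measure_union _ measurableSet_Ioc]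
    · rw [Set.Ioc_union_Ioc_eq_Ioc (by linarith)
        (by linarith [(Nat.cast_nonneg m : (0 : ℝ) ≤ m)])]
      congr 2
      push_cast
      ring
    · exact Set.disjoint_left.2 fun t ht ht' => absurd ht.2 (not_le.2 ht'.1)

/-- The convolution of `μ` with the sum of the unit masses at the points `a i + l`, where
`0 ≤ l < m i`. -/
noncomputable def unitCutMeasure {n : ℕ} (a : Fin n → ℝ) (m : Fin n → ℕ) (μ : Measure ℝ) :
    Measure ℝ :=
  ∑ i, ∑ l ∈ Finset.range (m i), μ.map (· + (a i + l))

lemma measure_preimage_add_le_unitCutMeasure {n : ℕ} (a : Fin n → ℝ) (m : Fin n → ℕ)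
    (μ : Measure ℝ) {i : Fin n} (hi : m i ≠ 0) {s : Set ℝ} (hs : MeasurableSet s) :
    μ ((· + a i) ⁻¹' s) ≤ unitCutMeasure a m μ s := by
  rw [unitCutMeasure, Measure.finsetSum_apply]
  refine le_trans ?_ (Finset.single_le_sum (fun _ _ => zero_le) (Finset.mem_univ i))
  rw [Measure.finsetSum_apply]
  refine le_trans ?_ (Finset.single_le_sum (fun _ _ => zero_le)
    (Finset.mem_range.2 (Nat.pos_of_ne_zero hi)))
  rw [Measure.map_apply (measurable_add_const _) hs]
  simp

lemma ae_unitCutMeasure_Ioc_eq_one {n : ℕ} {I : Fin n → Set ℝ} {a b : Fin n → ℝ}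
    (hI : ∀ i, IsIntervalWithEndpoints (I i) (a i) (b i))
    (hdisj : ∀ i j, i ≠ j → Disjoint (I i) (I j)) {m : Fin n → ℕ}
    (hm : ∀ i, b i = a i + m i) {μ : Measure ℝ} [SigmaFinite μ]
    (hμ : ∀ᵐ x ∂(volume : Measure ℝ), indicatorConv (⋃ i, I i) μ x = 1) :
    ∀ᵐ x ∂(volume : Measure ℝ), unitCutMeasure a m μ (Set.Ioc (x - 1) x) = 1 := by
  filter_upwards [hμ, ae_all_iff.2 fun i => ae_measure_singleton_sub_eq_zero μ (a i),
    ae_all_iff.2 fun i => ae_measure_singleton_sub_eq_zero μ (b i)] with x hx ha hb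
  have hmeas (i : Fin n) : MeasurableSet ((fun t => x - t) ⁻¹' I i) :=
    (measurable_const.sub measurable_id) (hI i).measurableSet
  rw [← hx, indicatorConv_eq_measure_preimage (MeasurableSet.iUnion fun i => (hI i).measurableSet),
    Set.preimage_iUnion, measure_iUnion (fun i j hij => (hdisj i j hij).preimage _) hmeas,
    tsum_fintype, unitCutMeasure, Measure.finsetSum_apply]
  refine Finset.sum_congr rfl fun i _ => ?_
  rw [Measure.finsetSum_apply, sum_map_add_apply_Ioc, (hI i).measure_preimage_sub (ha i) (hb i),
    hm i]

lemma IsIntervalWithEndpoints.exists_natCast_length {I : Set ℝ} {a b : ℝ}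
    (h : IsIntervalWithEndpoints I a b) (hlen : ∃ m : ℤ, b - a = (m : ℝ)) :
    ∃ m : ℕ, m ≠ 0 ∧ b = a + m := by
  obtain ⟨m, hm⟩ := hlen
  have hpos : 0 < m := by
    have : (0 : ℝ) < m := by linarith [h.1]
    exact_mod_cast this
  lift m to ℕ using hpos.le
  refine ⟨m, by omega, ?_⟩
  push_cast at hm
  linarith

/-! ### Consequences for a weak tiling measure -/

/-- The unit mass at `0` gives `unitCutMeasure` an atom of mass at least one at `a i`. -/
lemma one_le_unitCutMeasure_singleton {n : ℕ} (a : Fin n → ℝ) {m : Fin n → ℕ} (ν : Measure ℝ)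
    {i : Fin n} (hi : m i ≠ 0) :
    1 + ν {0} ≤ unitCutMeasure a m (Measure.dirac 0 + ν) {a i} := by
  refine le_trans (le_of_eq ?_) (measure_preimage_add_le_unitCutMeasure a m _ hi
    (measurableSet_singleton _))
  have : (· + a i) ⁻¹' {a i} = ({0} : Set ℝ) := by ext; simp
  rw [this]
  simp

lemma support_subset_int_diff_zero {ν : Measure ℝ}
    (hint : ν (Set.range fun k : ℤ => (k : ℝ))ᶜ = 0) (h0 : ν {0} = 0) :
    ν.support ⊆ Set.range (fun k : ℤ => (k : ℝ)) \ {0} := by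
  have himage : Set.range (fun k : ℤ => (k : ℝ)) \ {0} = (fun k : ℤ => (k : ℝ)) '' {0}ᶜ := by
    ext y
    constructor
    · rintro ⟨⟨k, rfl⟩, hk⟩
      exact ⟨k, by simpa using hk, rfl⟩
    · rintro ⟨k, hk, rfl⟩
      exact ⟨⟨k, rfl⟩, by simpa using hk⟩
  refine Measure.support_subset_of_isClosed ?_ ?_
  · rw [himage]
    exact Int.isClosedEmbedding_coe_real.isClosedMap _ (isClosed_discrete _)
  · rw [mem_ae_iff, Set.sdiff_eq, Set.compl_inter, compl_compl]
    exact measure_union_null hint h0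

/-- All the `a i` are congruent modulo one: the cut measure is carried by `a i + ℤ` for each `i`,
and has an atom at each `a j`. -/
lemma exists_int_sub_eq {n : ℕ} {a : Fin n → ℝ} {m : Fin n → ℕ} (hm0 : ∀ i, m i ≠ 0)
    {ν : Measure ℝ}
    (h : ∀ᵐ x ∂(volume : Measure ℝ),
      unitCutMeasure a m (Measure.dirac 0 + ν) (Set.Ioc (x - 1) x) = 1) (i j : Fin n) :
    ∃ k : ℤ, a j - a i = (k : ℝ) := by
  have hone (i : Fin n) := le_self_add.trans (one_le_unitCutMeasure_singleton a ν (hm0 i))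
  by_contra hk
  have hsub : {a j} ⊆ (Set.range fun k : ℤ => a i + (k : ℝ))ᶜ := by
    rintro _ rfl ⟨k, hk'⟩
    exact hk ⟨k, by rw [← hk']; ring⟩
  have hzero := measure_mono_null hsub (measure_compl_range_add_int_eq_zero h (hone i))
  exact absurd (hone j) (by simp [hzero])

lemma support_subset_of_unitCutMeasure {n : ℕ} {a : Fin n → ℝ} {m : Fin n → ℕ}
    {ν : Measure ℝ}
    (h : ∀ᵐ x ∂(volume : Measure ℝ),
      unitCutMeasure a m (Measure.dirac 0 + ν) (Set.Ioc (x - 1) x) = 1) {i : Fin n}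
    (hi : m i ≠ 0) :
    ν.support ⊆ Set.range (fun k : ℤ => (k : ℝ)) \ {0} := by
  have hone := one_le_unitCutMeasure_singleton a ν hi
  refine support_subset_int_diff_zero ?_ ?_
  · have hmeas : MeasurableSet (Set.range fun k : ℤ => a i + (k : ℝ))ᶜ :=
      (Set.countable_range _).measurableSet.compl
    have hzero := measure_preimage_add_le_unitCutMeasure a m (Measure.dirac 0 + ν) hi hmeas
    rw [measure_compl_range_add_int_eq_zero h (le_self_add.trans hone), nonpos_iff_eq_zero,
      Measure.add_apply, add_eq_zero] at hzero
    refine measure_mono_null ?_ hzero.2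
    rintro y hy ⟨k, hk⟩
    exact hy ⟨k, by linarith [show a i + (k : ℝ) = y + a i from hk]⟩
  · have hle := hone.trans (measure_singleton_le_one h (a i))
    rw [← nonpos_iff_eq_zero]
    exact (ENNReal.add_le_add_iff_left ENNReal.one_ne_top).1 (by rwa [add_zero])

theorem theorem3p8 (n : ℕ) (I : Fin n → Set ℝ) (a b : Fin n → ℝ)
    (hI : ∀ i, IsIntervalWithEndpoints (I i) (a i) (b i))
    (hdisj : ∀ i j, i ≠ j → Disjoint (I i) (I j))
    -- the intervals are listed from left to right
    (hord : StrictMono a)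
    (hlen : ∀ i, ∃ m : ℤ, b i - a i = (m : ℝ))
    (hweak : WeaklyTilesComplement (⋃ i, I i)) :
    (∀ (k : ℕ) (hk : k + 1 < n),
      ∃ m : ℤ, a ⟨k + 1, hk⟩ - b ⟨k, Nat.lt_of_succ_lt hk⟩ = (m : ℝ)) ∧
    (∀ ν : Measure ℝ, IsWeakTilingMeasure ν (⋃ i, I i) →
      ν.support ⊆ Set.range (fun m : ℤ => (m : ℝ)) \ {0}) := by
  choose m hm0 hm using fun i => (hI i).exists_natCast_length (hlen i)
  have key (ν : Measure ℝ) (hν : IsWeakTilingMeasure ν (⋃ i, I i)) :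
      ∀ᵐ x ∂(volume : Measure ℝ),
        unitCutMeasure a m (Measure.dirac 0 + ν) (Set.Ioc (x - 1) x) = 1 := by
    have := hν.1
    exact ae_unitCutMeasure_Ioc_eq_one hI hdisj hm hν.indicatorConv_dirac_add
  refine ⟨fun k hk => ?_, fun ν hν => ?_⟩
  · obtain ⟨ν, hν⟩ := hweak
    obtain ⟨z, hz⟩ := exists_int_sub_eq hm0 (key ν hν) ⟨k, Nat.lt_of_succ_lt hk⟩ ⟨k + 1, hk⟩
    refine ⟨z - m ⟨k, Nat.lt_of_succ_lt hk⟩, ?_⟩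
    rw [hm]
    push_cast
    linarith
  · rcases Nat.eq_zero_or_pos n with rfl | hn
    · -- The empty set has no weak tiling measure.
      obtain ⟨x, hx⟩ := (key ν hν).exists
      simp [unitCutMeasure] at hx
    · exact support_subset_of_unitCutMeasure (key ν hν) (hm0 ⟨0, hn⟩)
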